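/- Let $\omega(n)$ denote the number of distinct prime factors of a positive integer $n$ and $d(n)$ the number of its positive divisors. Then the integer sequences $a_n=\omega(n)$ and $a_n=\lfloor \log d(n)\rfloor$ ($n\ge 1$, natural logarithm) both have the strong sweeping out property: for every compact metric space $X$ with Borel $\sigma$-algebra $\mathcal B$, every non-atomic Borel probability measure $\mu$ on $X$, every ergodic $\mu$-preserving transformation $T:X\to X$, and every $\varepsilon>0$, there is a set $A\in\mathcal B$ with $\mu(A)<\varepsilon$ such that, for $\mu$-almost every $x\in X$, $$\limsup_{N\to\infty}\frac1N\sum_{n=1}^N \mathbb 1_A(T^{a_n}x)=1\qquad\text{and}\qquad \liminf_{N\to\infty}\frac1N\sum_{n=1}^N \mathbb 1_A(T^{a_n}x)=0 .$$ -/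

import Mathlib

open Filter MeasureTheory

universe u

/-- The Cesàro average `(1/N) ∑_{n=1}^N 1_A(T^{a n} x)` of the visits to `A` along the
sequence `a`. -/
noncomputable def visitAverage {X : Type*} (T : X → X) (a : ℕ → ℕ) (A : Set X) (x : X)
    (N : ℕ) : ℝ :=
  (1 / (N : ℝ)) * ∑ n ∈ Finset.Icc 1 N, A.indicator (fun _ => (1 : ℝ)) (T^[a n] x)

/-- The strong sweeping out property (for Cesàro averages) of a sequence `a 1, a 2, …` of
non-negative integers. A non-atomic ergodic system is a compact metric space with its Borel
`σ`-algebra, a non-atomic Borel probability measure, and an ergodic measure-preserving (not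
necessarily continuous or invertible) transformation. The averages lie in `[0, 1]`, so the real
`limsup` and `liminf` are the genuine ones. -/
def StrongSweepingOut (a : ℕ → ℕ) : Prop :=
  ∀ (X : Type u) [MetricSpace X] [CompactSpace X] [MeasurableSpace X] [BorelSpace X]
    (μ : Measure X) [IsProbabilityMeasure μ] [NullSingletonClass μ] (T : X → X), Ergodic T μ →
    ∀ ε : ℝ, 0 < ε →
      ∃ A : Set X, MeasurableSet A ∧ μ A < ENNReal.ofReal ε ∧
        ∀ᵐ x ∂μ,
          limsup (fun N : ℕ => visitAverage T a A x N) atTop = 1 ∧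
          liminf (fun N : ℕ => visitAverage T a A x N) atTop = 0

/-! By Turán's inequality `ω(n)` is within a small proportion of `M(N) = ∑_{p ≤ N} 1/p` for most `n
≤ N`. Since `M` tends to infinity in steps of at most 1, every large `q` has an `N` for which most
`a n` lie just below `q` (`HasNormalOrder.hasShortWindows`). For `⌊log d(n)⌋` the same holds with
`log 2 · M`, because `d(n)` is `2 ^ ω(n)` up to a factor controlled by the square part of `n`.

A Rokhlin-type set `E` of measure at most `2 / h` is met by almost every orbit within time `h`, so
almost every `x` has a large `q < 2h` with `T^q x ∈ E`. Thickening `E` backwards by the window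
length gives a small set `C` containing `T^{a n} x` for most `n ≤ N`
(`Ergodic.exists_small_set_visited_along`).

Finally such sets `C i` are chosen with rapidly decreasing measure, and points are sorted by the
parity of the last `C i` containing them. By Borel–Cantelli later sets eventually do not disturb
stage `i`, so averages near 1 and near 0 alternate (`Ergodic.exists_sweeping_set`). -/

/-- For all large `q` some initial segment `1, …, N`, with `N` as large as desired, has almost all
of its values `a n` in the short window `[(1 - δ) q, q]`. -/
def HasShortWindows (a : ℕ → ℕ) : Prop :=
  ∀ δ : ℝ, 0 < δ → ∀ N₀ : ℕ, ∃ q₀ : ℕ, ∀ q : ℕ, q₀ ≤ q → ∃ N : ℕ, N₀ ≤ N ∧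
    ∃ B : Finset ℕ, (B.card : ℝ) ≤ δ * N ∧
      ∀ n ∈ Finset.Icc 1 N, n ∉ B → (1 - δ) * (q : ℝ) ≤ (a n : ℝ) ∧ a n ≤ q

/-! ### Rokhlin-type sets and small sets visited along `a`. -/

/-- Take a point of the support: its neighbourhoods have positive measure, and outer regularity
makes one of them small because the point is null. -/
theorem exists_measurableSet_measure_pos_lt {X : Type*} [TopologicalSpace X]
    [SecondCountableTopology X] [MeasurableSpace X] [OpensMeasurableSpace X] (μ : Measure X)
    [μ.OuterRegular] [NeZero μ] [NullSingletonClass μ] {η : ENNReal} (hη : 0 < η) :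
    ∃ F : Set X, MeasurableSet F ∧ 0 < μ F ∧ μ F < η := by
  obtain ⟨x, -, hx⟩ := exists_mem_forall_mem_nhdsWithin_pos_measure (μ := μ) (s := Set.univ)
    (by simpa using NeZero.ne μ)
  obtain ⟨U, hxU, hU, hUη⟩ := Set.exists_isOpen_lt_of_lt ({x} : Set X) η (μ := μ) (by simpa)
  exact ⟨U, hU.measurableSet,
    hx U (mem_nhdsWithin_of_mem_nhds (hU.mem_nhds (hxU (Set.mem_singleton x)))), hUη⟩

/-- The points whose first visit to `F` under `T` takes place at time `k`. -/
def firstHitSet {X : Type*} (T : X → X) (F : Set X) (k : ℕ) : Set X :=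
  {x | T^[k] x ∈ F ∧ ∀ j < k, T^[j] x ∉ F}

/-- The first visit to `F` after time `i` comes at least `h` later, hence after time `j`. Both
conditions thus describe the same visit, forcing `h ∣ j - i`, which is impossible. -/
theorem disjoint_preimage_firstHitSet {X : Type*} {T : X → X} {F : Set X} {h i j : ℕ} (hij : i < j) (hj : j < h) :
    Disjoint (T^[i] ⁻¹' ⋃ k : ℕ, firstHitSet T F (h * (k + 1)))
      (T^[j] ⁻¹' ⋃ k : ℕ, firstHitSet T F (h * (k + 1))) := by
  rw [Set.disjoint_left]
  intro x hxi hxj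
  obtain ⟨k, hk, hk'⟩ := Set.mem_iUnion.1 hxi
  obtain ⟨l, hl, hl'⟩ := Set.mem_iUnion.1 hxj
  simp only [← Function.iterate_add_apply] at hk hk' hl hl'
  have hkh : h ≤ h * (k + 1) := Nat.le_mul_of_pos_right h k.succ_pos
  have h1 : h * (l + 1) ≤ h * (k + 1) + i - j := by
    by_contra! hlt
    apply hl' _ hlt
    rwa [show h * (k + 1) + i - j + j = h * (k + 1) + i by omega]
  have h2 : h * (k + 1) ≤ h * (l + 1) + j - i := by
    by_contra! hlt
    apply hk' _ hlt
    rwa [show h * (l + 1) + j - i + i = h * (l + 1) + j by omega]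
  have h3 : l + 1 < k + 1 := lt_of_mul_lt_mul_left (show h * (l + 1) < h * (k + 1) by omega) h.zero_le
  have h4 : h * (l + 2) ≤ h * (k + 1) := Nat.mul_le_mul_left h h3
  have h5 : h * (l + 2) = h * (l + 1) + h := by ring
  omega

section Ergodic

variable {X : Type*} [MeasurableSpace X] {μ : Measure X} {T : X → X}

theorem Ergodic.ae_exists_iterate_mem [IsFiniteMeasure μ] (hT : Ergodic T μ) {F : Set X}
    (hF : MeasurableSet F) (hF0 : μ F ≠ 0) : ∀ᵐ x ∂μ, ∃ n : ℕ, T^[n] x ∈ F := by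
  set G : Set X := ⋃ n : ℕ, T^[n] ⁻¹' F with hG
  have hGm : MeasurableSet G := MeasurableSet.iUnion fun n => hT.measurable.iterate n hF
  have hsub : T ⁻¹' G ⊆ G := by
    intro x hx
    obtain ⟨n, hn⟩ := Set.mem_iUnion.1 hx
    exact Set.mem_iUnion.2 ⟨n + 1, by simpa [Function.iterate_succ_apply] using hn⟩
  rcases hT.ae_empty_or_univ_of_preimage_ae_le hGm.nullMeasurableSet
    (Eventually.of_forall hsub) with h | h
  · have hFG : F ⊆ G := fun x hx => Set.mem_iUnion.2 ⟨0, hx⟩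
    exact absurd (measure_mono_null hFG (ae_eq_empty.1 h)) hF0
  · filter_upwards [eventuallyEq_univ.1 h] with x hx
    simpa [hG] using hx

theorem measurableSet_firstHitSet (hT : Measurable T) {F : Set X} (hF : MeasurableSet F) (k : ℕ) :
    MeasurableSet (firstHitSet T F k) := by
  have : firstHitSet T F k = T^[k] ⁻¹' F ∩ ⋂ j, ⋂ (_ : j < k), (T^[j] ⁻¹' F)ᶜ := by
    ext x; simp [firstHitSet]
  rw [this]
  exact (hT.iterate k hF).inter (MeasurableSet.iInter fun j => MeasurableSet.iInter fun _ =>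
    (hT.iterate j hF).compl)

/-- A one-sided Rokhlin lemma: a set of measure at most `2 / h` that almost every orbit meets within
time `h`. -/
theorem Ergodic.exists_small_set_hit_within [IsProbabilityMeasure μ] (hT : Ergodic T μ)
    (hμ : ∀ η : ENNReal, 0 < η → ∃ F : Set X, MeasurableSet F ∧ 0 < μ F ∧ μ F < η)
    {h : ℕ} (hh : 0 < h) :
    ∃ E : Set X, MeasurableSet E ∧ μ E ≤ 2 / h ∧ ∀ᵐ x ∂μ, ∃ r < h, T^[r] x ∈ E := by
  obtain ⟨F, hF, hF0, hFh⟩ := hμ (1 / h) (by simp)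
  set E₀ : Set X := ⋃ k : ℕ, firstHitSet T F (h * (k + 1)) with hE₀
  have hE₀m : MeasurableSet E₀ :=
    MeasurableSet.iUnion fun k => measurableSet_firstHitSet hT.measurable hF _
  have hE₀h : μ E₀ ≤ 1 / h := by
    have hsum : ∑ i ∈ Finset.range h, μ (T^[i] ⁻¹' E₀) ≤ 1 := by
      rw [← measure_biUnion_finset]
      · exact prob_le_one
      · intro i hi j hj hij
        simp only [Finset.coe_range, Set.mem_Iio] at hi hj
        rcases lt_or_gt_of_ne hij with hlt | hlt
        · exact disjoint_preimage_firstHitSet hlt hj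
        · exact (disjoint_preimage_firstHitSet hlt hi).symm
      · exact fun i _ => hT.measurable.iterate i hE₀m
    simp_rw [fun i => (hT.toMeasurePreserving.iterate i).measure_preimage hE₀m.nullMeasurableSet]
      at hsum
    rw [ENNReal.le_div_iff_mul_le (by simp [hh.ne']) (by simp)]
    simpa [mul_comm] using hsum
  refine ⟨F ∪ E₀, hF.union hE₀m, ?_, ?_⟩
  · calc μ (F ∪ E₀) ≤ μ F + μ E₀ := measure_union_le _ _
      _ ≤ 1 / h + 1 / h := add_le_add hFh.le hE₀h
      _ = 2 / h := by rw [ENNReal.div_add_div_same, one_add_one_eq_two]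
  · filter_upwards [hT.ae_exists_iterate_mem hF hF0.ne'] with x hx
    classical
    -- After `m % h` steps the waiting time is a multiple of `h`: zero puts the point in `F`,
    -- positive puts it in `E₀`.
    set m := Nat.find hx with hm
    refine ⟨m % h, Nat.mod_lt _ hh, ?_⟩
    have hdm := Nat.mod_add_div m h
    rcases Nat.eq_zero_or_pos (m / h) with h0 | h0
    · left
      rw [h0, mul_zero, add_zero] at hdm
      rw [hdm]
      exact Nat.find_spec hx
    · right
      refine Set.mem_iUnion.2 ⟨m / h - 1, ?_⟩
      rw [Nat.sub_add_cancel h0]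
      refine ⟨?_, fun j hj => ?_⟩
      · rw [← Function.iterate_add_apply, add_comm, hdm]
        exact Nat.find_spec hx
      · rw [← Function.iterate_add_apply]
        exact Nat.find_min hx (by omega)

theorem Ergodic.exists_small_set_visited_along [IsProbabilityMeasure μ] (hT : Ergodic T μ)
    (hμ : ∀ η : ENNReal, 0 < η → ∃ F : Set X, MeasurableSet F ∧ 0 < μ F ∧ μ F < η)
    {a : ℕ → ℕ} (ha : HasShortWindows a) {δ : ℝ} (hδ : 0 < δ) (N₀ : ℕ) :
    ∃ (C : Set X) (H : ℕ), MeasurableSet C ∧ μ C ≤ ENNReal.ofReal δ ∧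
      ∀ᵐ x ∂μ, ∃ N : ℕ, N₀ ≤ N ∧ ∃ B : Finset ℕ, (B.card : ℝ) ≤ δ * N ∧
        ∀ n ∈ Finset.Icc 1 N, n ∉ B → a n ≤ H ∧ T^[a n] x ∈ C := by
  obtain ⟨q₀, hq₀⟩ := ha (δ / 16) (by positivity) N₀
  obtain ⟨h₁, hh₁⟩ := exists_nat_gt (16 / δ)
  set h := max q₀ (max h₁ 1) with hh
  have hh0 : 0 < h := by omega
  have hhδ : 16 ≤ δ * h := by
    have : (h₁ : ℝ) ≤ h := by exact_mod_cast (by omega)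
    have := (div_lt_iff₀ hδ).1 (hh₁.trans_le this)
    linarith
  obtain ⟨E, hE, hEh, hhit⟩ := hT.exists_small_set_hit_within hμ hh0
  -- The window below `q < 2h` has length at most `(δ / 16) * 2h`.
  set L := ⌈δ * h / 8⌉₊ with hL
  have hL1 : δ * h / 8 ≤ L := Nat.le_ceil _
  have hL2 : (L : ℝ) < δ * h / 8 + 1 := Nat.ceil_lt_add_one (by positivity)
  refine ⟨⋃ i ∈ Finset.range (L + 1), T^[i] ⁻¹' E, 2 * h, ?_, ?_, ?_⟩
  · exact Finset.measurableSet_biUnion _ fun i _ => hT.measurable.iterate i hE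
  · calc μ (⋃ i ∈ Finset.range (L + 1), T^[i] ⁻¹' E)
        ≤ ∑ i ∈ Finset.range (L + 1), μ (T^[i] ⁻¹' E) := measure_biUnion_finset_le _ _
      _ = (L + 1) * μ E := by
        simp_rw [fun i => (hT.toMeasurePreserving.iterate i).measure_preimage hE.nullMeasurableSet]
        simp
      _ ≤ (L + 1) * (2 / h) := by gcongr
      _ = ENNReal.ofReal ((L + 1) * (2 / h)) := by
        rw [ENNReal.ofReal_mul (by positivity), ENNReal.ofReal_div_of_pos (by positivity),
          ENNReal.ofReal_add (by positivity) (by positivity)]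
        simp
      _ ≤ ENNReal.ofReal δ := by
        apply ENNReal.ofReal_le_ofReal
        have : (0 : ℝ) < h := by exact_mod_cast hh0
        rw [← mul_div_assoc, div_le_iff₀ this]
        linarith
  -- Starting from `T^[h] x` makes the hitting time `q = r + h` at least `q₀`.
  · filter_upwards [(hT.toMeasurePreserving.iterate h).quasiMeasurePreserving.ae hhit] with x hx
    obtain ⟨r, hr, hrE⟩ := hx
    rw [← Function.iterate_add_apply] at hrE
    obtain ⟨N, hN, B, hcard, hB⟩ := hq₀ (r + h) (by omega)
    refine ⟨N, hN, _, hcard.trans (by gcongr; linarith), fun n hn hnB => ?_⟩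
    obtain ⟨hw1, hw2⟩ := hB n hn hnB
    refine ⟨by omega, Set.mem_iUnion₂.2 ⟨r + h - a n, ?_, ?_⟩⟩
    · rw [Finset.mem_range, Nat.lt_succ_iff, tsub_le_iff_left]
      have h3 : (r : ℝ) ≤ h := by exact_mod_cast hr.le
      have : ((r + h : ℕ) : ℝ) ≤ (a n + L : ℕ) := by
        push_cast at hw1 ⊢
        nlinarith
      exact_mod_cast this
    · rwa [Set.mem_preimage, ← Function.iterate_add_apply, Nat.sub_add_cancel hw2]

end Ergodic

/-! ### Bounds for visit averages, and their limsup and liminf. -/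

section VisitAverage

variable {X : Type*} {T : X → X} {a : ℕ → ℕ} {A : Set X} {x : X} {N : ℕ}

theorem visitAverage_nonneg : 0 ≤ visitAverage T a A x N :=
  mul_nonneg (by positivity)
    (Finset.sum_nonneg fun _ _ => Set.indicator_nonneg (fun _ _ => zero_le_one) _)

theorem visitAverage_le {θ : ℝ} (hN : 0 < N) {B : Finset ℕ} (hB : (B.card : ℝ) ≤ θ * N)
    (h : ∀ n ∈ Finset.Icc 1 N, n ∉ B → T^[a n] x ∉ A) : visitAverage T a A x N ≤ θ := by
  have hN' : (0 : ℝ) < N := by exact_mod_cast hN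
  rw [visitAverage, one_div, inv_mul_le_iff₀ hN', mul_comm]
  refine le_trans ?_ hB
  calc _ ≤ ∑ n ∈ Finset.Icc 1 N, if n ∈ B then (1 : ℝ) else 0 := by
        refine Finset.sum_le_sum fun n hn => ?_
        by_cases hnB : n ∈ B
        · rw [if_pos hnB]
          exact Set.indicator_le_self' (fun _ _ => zero_le_one) _
        · rw [if_neg hnB, Set.indicator_of_notMem (h n hn hnB)]
    _ ≤ _ := by
        rw [Finset.sum_boole]
        exact_mod_cast Finset.card_le_card fun n hn => (Finset.mem_filter.1 hn).2

theorem visitAverage_add_compl (hN : 0 < N) :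
    visitAverage T a A x N + visitAverage T a Aᶜ x N = 1 := by
  have hN' : (N : ℝ) ≠ 0 := by exact_mod_cast hN.ne'
  have (y : X) : A.indicator (fun _ => (1 : ℝ)) y + Aᶜ.indicator (fun _ => (1 : ℝ)) y = 1 :=
    Set.indicator_self_add_compl_apply A (fun _ => (1 : ℝ)) y
  rw [visitAverage, visitAverage, ← mul_add, ← Finset.sum_add_distrib,
    Finset.sum_congr rfl fun n _ => this _]
  simp [hN']

theorem le_visitAverage {θ : ℝ} (hN : 0 < N) {B : Finset ℕ} (hB : (B.card : ℝ) ≤ θ * N)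
    (h : ∀ n ∈ Finset.Icc 1 N, n ∉ B → T^[a n] x ∈ A) : 1 - θ ≤ visitAverage T a A x N := by
  have := visitAverage_le (A := Aᶜ) hN hB fun n hn hnB => not_not.2 (h n hn hnB)
  linarith [visitAverage_add_compl (T := T) (a := a) (A := A) (x := x) hN]

theorem visitAverage_le_one : visitAverage T a A x N ≤ 1 := by
  rcases Nat.eq_zero_or_pos N with rfl | hN
  · simp [visitAverage]
  · linarith [visitAverage_add_compl (T := T) (a := a) (A := A) (x := x) hN,
      visitAverage_nonneg (T := T) (a := a) (A := Aᶜ) (x := x) (N := N)]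

end VisitAverage

theorem limsup_eq_of_frequently_le {u : ℕ → ℝ} {b c : ℝ} (hb : ∀ N, b ≤ u N) (hc : ∀ N, u N ≤ c)
    (h : ∀ θ > 0, ∃ᶠ N in atTop, c - θ ≤ u N) : limsup u atTop = c := by
  have hbdd : IsBoundedUnder (· ≤ ·) atTop u := isBoundedUnder_of ⟨c, hc⟩
  have hbdd' : IsBoundedUnder (· ≥ ·) atTop u := isBoundedUnder_of ⟨b, hb⟩
  refine le_antisymm (limsup_le_of_le hbdd'.isCoboundedUnder_le (Eventually.of_forall hc)) ?_
  refine le_of_forall_pos_le_add fun θ hθ => ?_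
  linarith [le_limsup_of_frequently_le (h θ hθ) hbdd]

theorem liminf_eq_of_frequently_le {u : ℕ → ℝ} {b c : ℝ} (hb : ∀ N, b ≤ u N) (hc : ∀ N, u N ≤ c)
    (h : ∀ θ > 0, ∃ᶠ N in atTop, u N ≤ b + θ) : liminf u atTop = b := by
  have hbdd : IsBoundedUnder (· ≤ ·) atTop u := isBoundedUnder_of ⟨c, hc⟩
  have hbdd' : IsBoundedUnder (· ≥ ·) atTop u := isBoundedUnder_of ⟨b, hb⟩
  refine le_antisymm ?_ (le_liminf_of_le hbdd.isCoboundedUnder_ge (Eventually.of_forall hb))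
  exact le_of_forall_pos_le_add fun θ hθ => liminf_le_of_frequently_le (h θ hθ) hbdd'

/-! ### Gluing the small sets into one sweeping set. -/

theorem tsum_ofReal_geometric_two {c : ℝ} (hc : 0 ≤ c) :
    ∑' m : ℕ, ENNReal.ofReal (c * (1 / 2) ^ m) = ENNReal.ofReal (2 * c) := by
  rw [← ENNReal.ofReal_tsum_of_nonneg (fun m => by positivity)
    (summable_geometric_two.mul_left c), tsum_mul_left, tsum_geometric_two, mul_comm]

/-- The points whose last visit to the sequence of sets `C` happens at an even index. -/
def lastVisitEven {X : Type*} (C : ℕ → Set X) : Set X :=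
  ⋃ k : ℕ, C (2 * k) \ ⋃ m : ℕ, C (2 * k + 1 + m)

theorem mem_lastVisitEven {X : Type*} {C : ℕ → Set X} {y : X} {i : ℕ} (hi : y ∈ C i)
    (h : ∀ m, y ∉ C (i + 1 + m)) : y ∈ lastVisitEven C ↔ Even i := by
  constructor
  · intro hy
    obtain ⟨k, hk, hk'⟩ := Set.mem_iUnion.1 hy
    have h1 : i ≤ 2 * k := by
      by_contra! hlt
      refine hk' (Set.mem_iUnion.2 ⟨i - (2 * k + 1), ?_⟩)
      rwa [Nat.add_sub_cancel' hlt]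
    have h2 : 2 * k ≤ i := by
      by_contra! hlt
      refine h (2 * k - (i + 1)) ?_
      rwa [Nat.add_sub_cancel' hlt]
    exact ⟨k, by omega⟩
  · rintro ⟨k, rfl⟩
    rw [← two_mul] at hi h
    exact Set.mem_iUnion.2 ⟨k, hi, by simpa using h⟩

theorem Ergodic.exists_sweeping_set {X : Type*} [MeasurableSpace X] {μ : Measure X} {T : X → X}
    [IsProbabilityMeasure μ] (hT : Ergodic T μ)
    (hμ : ∀ η : ENNReal, 0 < η → ∃ F : Set X, MeasurableSet F ∧ 0 < μ F ∧ μ F < η)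
    {a : ℕ → ℕ} (ha : HasShortWindows a) {ε : ℝ} (hε : 0 < ε) :
    ∃ A : Set X, MeasurableSet A ∧ μ A < ENNReal.ofReal ε ∧
      ∀ᵐ x ∂μ,
        limsup (fun N : ℕ => visitAverage T a A x N) atTop = 1 ∧
        liminf (fun N : ℕ => visitAverage T a A x N) atTop = 0 := by
  choose! C₀ H₀ hC₀ using fun (δ : ℝ) (hδ : 0 < δ) (N₀ : ℕ) =>
    hT.exists_small_set_visited_along hμ ha hδ N₀
  set η : ℝ := min ε 1 / 4 with hη
  have hη0 : 0 < η := by positivity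
  have hη1 : η ≤ 1 := by rw [hη]; linarith [min_le_right ε 1]
  have hηε : 2 * η < ε := by rw [hη]; linarith [min_le_left ε 1]
  -- `K n` bounds the times used before stage `n`; dividing by `K + 1` pays for the `K + 1`
  -- preimages in `D`.
  let δ : ℕ → ℕ → ℝ := fun n K => η * (1 / 2) ^ n / (K + 1)
  have hδ0 : ∀ n K, 0 < δ n K := fun n K => by positivity
  have hδle : ∀ n K, δ n K ≤ η * (1 / 2) ^ n := fun n K =>
    div_le_self (by positivity) (by linarith [(Nat.cast_nonneg K : (0 : ℝ) ≤ K)])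
  let K : ℕ → ℕ := fun n => Nat.rec 0 (fun n K => max K (H₀ (δ n K) n)) n
  have hKsucc : ∀ n, K (n + 1) = max (K n) (H₀ (δ n (K n)) n) := fun n => rfl
  have hKmono : Monotone K := monotone_nat_of_le_succ fun n => hKsucc n ▸ le_max_left _ _
  let C : ℕ → Set X := fun n => C₀ (δ n (K n)) n
  have hCm : ∀ n, MeasurableSet (C n) := fun n => (hC₀ _ (hδ0 n (K n)) n).1
  have hCμ : ∀ n, μ (C n) ≤ ENNReal.ofReal (δ n (K n)) := fun n => (hC₀ _ (hδ0 n (K n)) n).2.1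
  have hCμ' : ∀ n, μ (C n) ≤ ENNReal.ofReal (η * (1 / 2) ^ n) := fun n =>
    (hCμ n).trans (ENNReal.ofReal_le_ofReal (hδle _ _))
  have hvisit : ∀ᵐ x ∂μ, ∀ i, ∃ N : ℕ, i ≤ N ∧ ∃ B : Finset ℕ,
      (B.card : ℝ) ≤ (1 / 2) ^ i * N ∧
        ∀ n ∈ Finset.Icc 1 N, n ∉ B → a n ≤ K (i + 1) ∧ T^[a n] x ∈ C i := by
    rw [ae_all_iff]
    intro i
    filter_upwards [(hC₀ _ (hδ0 i (K i)) i).2.2] with x hx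
    obtain ⟨N, hN, B, hB, h⟩ := hx
    refine ⟨N, hN, B, hB.trans ?_, fun n hn hnB =>
      ⟨(h n hn hnB).1.trans (hKsucc i ▸ le_max_right _ _), (h n hn hnB).2⟩⟩
    gcongr
    exact (hδle _ _).trans (mul_le_of_le_one_left (by positivity) hη1)
  -- Bad points for stage `i`: some iterate within its time range lies in a later set.
  let D : ℕ → Set X := fun i => ⋃ m : ℕ, ⋃ t ∈ Finset.range (K (i + 1) + 1), T^[t] ⁻¹' C (i + 1 + m)
  have hD : ∀ i, μ (D i) ≤ ENNReal.ofReal (2 * (η * (1 / 2) ^ (i + 1))) := by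
    intro i
    rw [← tsum_ofReal_geometric_two (by positivity)]
    refine (measure_iUnion_le _).trans (ENNReal.tsum_le_tsum fun m => ?_)
    calc _ ≤ ∑ t ∈ Finset.range (K (i + 1) + 1), μ (T^[t] ⁻¹' C (i + 1 + m)) :=
          measure_biUnion_finset_le _ _
      _ = (K (i + 1) + 1 : ℕ) * μ (C (i + 1 + m)) := by
        simp_rw [fun t => (hT.toMeasurePreserving.iterate t).measure_preimage
          (hCm (i + 1 + m)).nullMeasurableSet]
        simp
      _ ≤ (K (i + 1 + m) + 1 : ℕ) *
          ENNReal.ofReal (δ (i + 1 + m) (K (i + 1 + m))) := by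
        gcongr
        · exact hKmono (show i + 1 ≤ i + 1 + m by omega)
        · exact hCμ _
      _ = ENNReal.ofReal (η * (1 / 2) ^ (i + 1) * (1 / 2) ^ m) := by
        rw [← ENNReal.ofReal_natCast, ← ENNReal.ofReal_mul (by positivity)]
        congr 1
        simp only [δ]
        push_cast
        field_simp
        ring
  have hDsum : ∑' i, μ (D i) ≠ ⊤ := by
    refine ne_top_of_le_ne_top ?_ (ENNReal.tsum_le_tsum hD)
    have : ∀ i : ℕ, 2 * (η * (1 / 2) ^ (i + 1)) = η * (1 / 2) ^ i := fun i => by ring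
    simp_rw [this, tsum_ofReal_geometric_two hη0.le]
    exact ENNReal.ofReal_ne_top
  refine ⟨lastVisitEven C, ?_, ?_, ?_⟩
  · exact MeasurableSet.iUnion fun k => (hCm _).diff (MeasurableSet.iUnion fun m => hCm _)
  · calc μ (lastVisitEven C) ≤ μ (⋃ n, C n) :=
          measure_mono (Set.iUnion_subset fun k => Set.sdiff_subset.trans (Set.subset_iUnion C _))
      _ ≤ ∑' n, μ (C n) := measure_iUnion_le _
      _ ≤ ∑' n, ENNReal.ofReal (η * (1 / 2) ^ n) := ENNReal.tsum_le_tsum hCμ'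
      _ = ENNReal.ofReal (2 * η) := tsum_ofReal_geometric_two hη0.le
      _ < ENNReal.ofReal ε := (ENNReal.ofReal_lt_ofReal_iff hε).2 hηε
  · filter_upwards [hvisit, ae_eventually_notMem hDsum] with x hx hxD
    have key : ∀ᶠ i in atTop, ∃ N : ℕ, i ≤ N ∧ ∃ B : Finset ℕ, (B.card : ℝ) ≤ (1 / 2) ^ i * N ∧
        ∀ n ∈ Finset.Icc 1 N, n ∉ B → (T^[a n] x ∈ lastVisitEven C ↔ Even i) := by
      filter_upwards [hxD] with i hi
      obtain ⟨N, hN, B, hB, h⟩ := hx i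
      refine ⟨N, hN, B, hB, fun n hn hnB => mem_lastVisitEven (h n hn hnB).2 fun m hm => hi ?_⟩
      refine Set.mem_iUnion.2 ⟨m, Set.mem_iUnion₂.2 ⟨a n, ?_, hm⟩⟩
      exact Finset.mem_range.2 (Nat.lt_succ_of_le (h n hn hnB).1)
    have hsmall : ∀ θ > 0, ∀ᶠ i : ℕ in atTop, ((1 : ℝ) / 2) ^ i ≤ θ := fun θ hθ =>
      (tendsto_pow_atTop_nhds_zero_of_lt_one (by norm_num) (by norm_num)).eventually
        (ge_mem_nhds hθ)
    constructor
    · refine limsup_eq_of_frequently_le (fun _ => visitAverage_nonneg)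
        (fun _ => visitAverage_le_one) fun θ hθ => frequently_atTop.2 fun M => ?_
      obtain ⟨i, ⟨⟨N, hN, B, hB, h⟩, hiθ, hiM⟩, hi⟩ := ((key.and ((hsmall θ hθ).and
        (eventually_gt_atTop M))).and_frequently Nat.frequently_even).exists
      refine ⟨N, by omega, (sub_le_sub_left hiθ 1).trans ?_⟩
      exact le_visitAverage (by omega) hB fun n hn hnB => (h n hn hnB).2 hi
    · refine liminf_eq_of_frequently_le (fun _ => visitAverage_nonneg)
        (fun _ => visitAverage_le_one) fun θ hθ => frequently_atTop.2 fun M => ?_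
      obtain ⟨i, ⟨⟨N, hN, B, hB, h⟩, hiθ, hiM⟩, hi⟩ := ((key.and ((hsmall θ hθ).and
        (eventually_gt_atTop M))).and_frequently Nat.frequently_odd).exists
      refine ⟨N, by omega, le_trans ?_ (hiθ.trans (zero_add θ).ge)⟩
      exact visitAverage_le (by omega) hB fun n hn hnB hmem =>
        Nat.not_even_iff_odd.2 hi ((h n hn hnB).1 hmem)

theorem HasShortWindows.strongSweepingOut {a : ℕ → ℕ} (ha : HasShortWindows a) :
    StrongSweepingOut.{u} a := by
  intro X _ _ _ _ μ _ _ T hT ε hε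
  exact hT.exists_sweeping_set (fun η hη => exists_measurableSet_measure_pos_lt μ hη) ha hε

/-! ### From normal order to short windows. -/

/-- `a` has normal order `M`: for every `δ > 0` and all large `N`, all but `δ N` of the integers
`n ≤ N` satisfy `|a n - M N| ≤ δ M N`. -/
def HasNormalOrder (a M : ℕ → ℝ) : Prop :=
  ∀ δ : ℝ, 0 < δ → ∀ᶠ N : ℕ in atTop, ∃ B : Finset ℕ, (B.card : ℝ) ≤ δ * N ∧
    ∀ n ∈ Finset.Icc 1 N, n ∉ B → |a n - M N| ≤ δ * M N

/-- Stop just before `M` exceeds `(1 - 2κ) q`. A step is at most `1 ≤ κ q`, so `M N` lies between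
`(1 - 3κ) q` and `(1 - 2κ) q`, and a relative error `κ` stays within `[(1 - 4κ) q, q]`. -/
theorem HasNormalOrder.hasShortWindows {a : ℕ → ℕ} {M : ℕ → ℝ}
    (ha : HasNormalOrder (fun n => (a n : ℝ)) M) (hM : Monotone M)
    (hM' : Tendsto M atTop atTop) (hstep : ∀ N, M (N + 1) ≤ M N + 1) : HasShortWindows a := by
  intro δ hδ N₀
  set κ : ℝ := min δ 1 / 4 with hκ
  have hκ0 : 0 < κ := by positivity
  have hκ1 : 4 * κ ≤ 1 := by rw [hκ]; linarith [min_le_right δ 1]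
  have hκδ : 4 * κ ≤ δ := by rw [hκ]; linarith [min_le_left δ 1]
  obtain ⟨N₁, hN₁⟩ := eventually_atTop.1 (ha κ hκ0)
  set N₂ := max N₀ N₁ with hN₂
  obtain ⟨q₁, hq₁⟩ := exists_nat_ge (2 * M N₂)
  obtain ⟨q₂, hq₂⟩ := exists_nat_ge (1 / κ)
  refine ⟨max q₁ q₂, fun q hq => ?_⟩
  have hqM : 2 * M N₂ ≤ q := hq₁.trans (by exact_mod_cast (le_max_left _ _).trans hq)
  have hqκ : 1 ≤ κ * q := by
    have : 1 / κ ≤ q := hq₂.trans (by exact_mod_cast (le_max_right _ _).trans hq)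
    rwa [div_le_iff₀ hκ0, mul_comm] at this
  have hq0 : (0 : ℝ) ≤ q := Nat.cast_nonneg q
  have hex : ∃ N, (1 - 2 * κ) * q < M N := (hM'.eventually_gt_atTop _).exists
  classical
  have hlt : N₂ < Nat.find hex := by
    by_contra! hle
    have h1 := Nat.find_spec hex
    have h2 := hM hle
    nlinarith
  obtain ⟨N, hN⟩ : ∃ N, Nat.find hex = N + 1 := ⟨Nat.find hex - 1, by omega⟩
  have hup : M N ≤ (1 - 2 * κ) * q := not_lt.1 (Nat.find_min hex (by omega))
  have hlow : (1 - 2 * κ) * q < M (N + 1) := hN ▸ Nat.find_spec hex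
  have hlow' : (1 - 3 * κ) * q ≤ M N := by linarith [hstep N]
  obtain ⟨B, hB, h⟩ := hN₁ N (by omega)
  refine ⟨N, by omega, B, hB.trans (by gcongr; linarith), fun n hn hnB => ?_⟩
  obtain ⟨h1, h2⟩ := abs_le.1 (h n hn hnB)
  have hκq : 0 ≤ κ * κ * q := by positivity
  constructor
  · have h3 : (1 - κ) * ((1 - 3 * κ) * q) ≤ (1 - κ) * M N :=
      mul_le_mul_of_nonneg_left hlow' (by linarith)
    have h4 : 4 * κ * q ≤ δ * q := by gcongr
    linarith
  · have h3 : (1 + κ) * M N ≤ (1 + κ) * ((1 - 2 * κ) * q) :=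
      mul_le_mul_of_nonneg_left hup (by linarith)
    have : (a n : ℝ) ≤ q := by linarith [mul_nonneg hκ0.le hq0]
    exact_mod_cast this

theorem HasNormalOrder.of_abs_sub_mul_le {a b M : ℕ → ℝ} {c : ℝ} (ha : HasNormalOrder a M)
    (hM : Tendsto M atTop atTop) (hc : 0 < c)
    (hb : ∀ κ : ℝ, 0 < κ → ∃ K : ℝ, ∀ N : ℕ, ∃ B : Finset ℕ, (B.card : ℝ) ≤ κ * N ∧
      ∀ n ∈ Finset.Icc 1 N, n ∉ B → |b n - c * a n| ≤ K) :
    HasNormalOrder b (fun N => c * M N) := by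
  intro δ hδ
  obtain ⟨K, hK⟩ := hb (δ / 2) (by positivity)
  filter_upwards [ha (δ / 2) (by positivity), hM.eventually_ge_atTop (2 * K / (δ * c))]
    with N ⟨B, hB, h⟩ hN
  obtain ⟨B', hB', h'⟩ := hK N
  classical
  refine ⟨B ∪ B', ?_, fun n hn hnB => ?_⟩
  · have : ((B ∪ B').card : ℝ) ≤ B.card + B'.card := by exact_mod_cast Finset.card_union_le B B'
    linarith
  · rw [Finset.mem_union, not_or] at hnB
    have h1 : |c * a n - c * M N| ≤ c * (δ / 2 * M N) := by
      rw [← mul_sub, abs_mul, abs_of_pos hc]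
      exact mul_le_mul_of_nonneg_left (h n hn hnB.1) hc.le
    have h2 : 2 * K ≤ M N * (δ * c) := (div_le_iff₀ (by positivity)).1 hN
    linarith [abs_sub_le (b n) (c * a n) (c * M N), h' n hn hnB.2]

/-! ### Turán's theorem on `ω`. -/

/-- The sum of the reciprocals of the primes up to `N`. -/
noncomputable def primeRecipSum (N : ℕ) : ℝ := ∑ p ∈ (N + 1).primesBelow, (1 / p : ℝ)

theorem primeRecipSum_nonneg (N : ℕ) : 0 ≤ primeRecipSum N :=
  Finset.sum_nonneg fun _ _ => by positivity

theorem primeRecipSum_eq_sum_indicator (N : ℕ) :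
    primeRecipSum N = ∑ n ∈ Finset.range (N + 1),
      Set.indicator {p : ℕ | p.Prime} (fun n : ℕ => (1 / n : ℝ)) n := by
  rw [primeRecipSum, Nat.primesBelow, Finset.sum_filter]
  exact Finset.sum_congr rfl fun n _ => by simp [Set.indicator_apply]

theorem primeRecipSum_mono : Monotone primeRecipSum := by
  refine monotone_nat_of_le_succ fun N => ?_
  rw [primeRecipSum_eq_sum_indicator, primeRecipSum_eq_sum_indicator,
    Finset.sum_range_succ _ (N + 1)]
  exact le_add_of_nonneg_right (Set.indicator_nonneg (fun _ _ => by positivity) _)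

theorem primeRecipSum_succ_le (N : ℕ) : primeRecipSum (N + 1) ≤ primeRecipSum N + 1 := by
  rw [primeRecipSum_eq_sum_indicator, primeRecipSum_eq_sum_indicator,
    Finset.sum_range_succ _ (N + 1)]
  gcongr
  refine Set.indicator_apply_le' (fun _ => ?_) fun _ => zero_le_one
  rw [div_le_one (by positivity)]
  exact_mod_cast Nat.le_add_left 1 N

theorem tendsto_primeRecipSum_atTop : Tendsto primeRecipSum atTop atTop := by
  have h := (not_summable_iff_tendsto_nat_atTop_of_nonneg
    (fun n => Set.indicator_nonneg (fun _ _ => by positivity) n)).1 not_summable_one_div_on_primes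
  simp_rw [funext primeRecipSum_eq_sum_indicator]
  exact (tendsto_add_atTop_iff_nat 1).2 h

theorem card_filter_dvd_Icc (N d : ℕ) : ((Finset.Icc 1 N).filter (d ∣ ·)).card = N / d :=
  Nat.Ioc_filter_dvd_card_eq_div N d

theorem cardDistinctFactors_eq_sum_primesBelow {n N : ℕ} (hn : n ∈ Finset.Icc 1 N) :
    (ArithmeticFunction.cardDistinctFactors n : ℝ) =
      ∑ p ∈ (N + 1).primesBelow, if p ∣ n then 1 else 0 := by
  obtain ⟨h1, h2⟩ := Finset.mem_Icc.1 hn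
  rw [show ArithmeticFunction.cardDistinctFactors n = n.primeFactors.card from rfl,
    Finset.sum_boole]
  congr 2
  ext p
  simp only [Nat.mem_primeFactors, Finset.mem_filter, Nat.mem_primesBelow]
  constructor
  · rintro ⟨hp, hpn, -⟩
    exact ⟨⟨Nat.lt_succ_of_le ((Nat.le_of_dvd h1 hpn).trans h2), hp⟩, hpn⟩
  · rintro ⟨⟨-, hp⟩, hpn⟩
    exact ⟨hp, hpn, Nat.ne_of_gt h1⟩

/-- Each prime loses at most 1 to the floor in `N / p`, and at most `N` primes occur. -/
theorem mul_primeRecipSum_sub_le_sum_cardDistinctFactors (N : ℕ) :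
    N * primeRecipSum N - N ≤
      ∑ n ∈ Finset.Icc 1 N, (ArithmeticFunction.cardDistinctFactors n : ℝ) := by
  rw [Finset.sum_congr rfl fun n hn => cardDistinctFactors_eq_sum_primesBelow hn, Finset.sum_comm]
  simp_rw [Finset.sum_boole, card_filter_dvd_Icc]
  have hcard : ((N + 1).primesBelow.card : ℝ) ≤ N := by
    have hsub : (N + 1).primesBelow ⊆ Finset.Icc 1 N := fun p hp => by
      obtain ⟨h1, h2⟩ := Nat.mem_primesBelow.1 hp
      exact Finset.mem_Icc.2 ⟨h2.one_le, Nat.le_of_lt_succ h1⟩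
    exact_mod_cast (Finset.card_le_card hsub).trans (by simp)
  calc (N * primeRecipSum N - N : ℝ)
      ≤ ∑ p ∈ (N + 1).primesBelow, (N * (1 / p) - 1 : ℝ) := by
        rw [Finset.sum_sub_distrib, ← Finset.mul_sum]
        rw [Finset.sum_const, nsmul_eq_mul, mul_one]
        exact sub_le_sub_left hcard _
    _ ≤ _ := Finset.sum_le_sum fun p _ => by
        rw [mul_one_div]
        rw [← Nat.floor_div_eq_div (K := ℝ)]
        exact (Nat.sub_one_lt_floor _).le

/-- Count pairs of prime divisors: distinct `p`, `q` contribute at most `N / (p q)`, and the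
diagonal gives the linear term. -/
theorem sum_cardDistinctFactors_sq_le (N : ℕ) :
    ∑ n ∈ Finset.Icc 1 N, (ArithmeticFunction.cardDistinctFactors n : ℝ) ^ 2 ≤
      N * primeRecipSum N ^ 2 + N * primeRecipSum N := by
  set P := (N + 1).primesBelow with hP
  calc ∑ n ∈ Finset.Icc 1 N, (ArithmeticFunction.cardDistinctFactors n : ℝ) ^ 2
      = ∑ n ∈ Finset.Icc 1 N, ∑ p ∈ P, ∑ q ∈ P, if p ∣ n ∧ q ∣ n then (1 : ℝ) else 0 := by
        refine Finset.sum_congr rfl fun n hn => ?_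
        rw [cardDistinctFactors_eq_sum_primesBelow hn, sq, Finset.sum_mul_sum]
        simp_rw [ite_zero_mul_ite_zero, mul_one, hP]
    _ = ∑ p ∈ P, ∑ q ∈ P, (((Finset.Icc 1 N).filter fun n => p ∣ n ∧ q ∣ n).card : ℝ) := by
        rw [Finset.sum_comm]
        refine Finset.sum_congr rfl fun p _ => ?_
        rw [Finset.sum_comm]
        simp_rw [Finset.sum_boole]
    _ ≤ ∑ p ∈ P, ∑ q ∈ P, (N * ((1 / p) * (1 / q)) + if p = q then N * (1 / p : ℝ) else 0) := by
        refine Finset.sum_le_sum fun p hp => Finset.sum_le_sum fun q hq => ?_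
        have hp := (Nat.mem_primesBelow.1 hp).2
        have hq := (Nat.mem_primesBelow.1 hq).2
        by_cases hpq : p = q
        · subst hpq
          simp only [and_self, if_true, card_filter_dvd_Icc]
          rw [mul_one_div (N : ℝ)]
          exact Nat.cast_div_le.trans (le_add_of_nonneg_left (by positivity))
        · rw [if_neg hpq, add_zero]
          have : ∀ n, p ∣ n ∧ q ∣ n ↔ p * q ∣ n := fun n =>
            ⟨fun h => ((Nat.coprime_primes hp hq).2 hpq).mul_dvd_of_dvd_of_dvd h.1 h.2,
              fun h => ⟨(dvd_mul_right p q).trans h, (dvd_mul_left q p).trans h⟩⟩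
          simp_rw [this, card_filter_dvd_Icc]
          refine Nat.cast_div_le.trans (le_of_eq ?_)
          push_cast
          rw [div_mul_div_comm, one_mul, mul_one_div]
    _ = N * primeRecipSum N ^ 2 + N * primeRecipSum N := by
        simp_rw [Finset.sum_add_distrib, ← Finset.mul_sum, Finset.sum_ite_eq]
        rw [← Finset.sum_mul, ← sq, Finset.sum_congr rfl fun p hp => if_pos hp, ← Finset.mul_sum]
        rfl

/-- Turán's inequality. -/
theorem sum_cardDistinctFactors_sub_sq_le (N : ℕ) :
    ∑ n ∈ Finset.Icc 1 N, ((ArithmeticFunction.cardDistinctFactors n : ℝ) - primeRecipSum N) ^ 2 ≤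
      3 * N * primeRecipSum N := by
  set L := primeRecipSum N with hL
  have hexp : ∑ n ∈ Finset.Icc 1 N, ((ArithmeticFunction.cardDistinctFactors n : ℝ) - L) ^ 2 =
      ∑ n ∈ Finset.Icc 1 N, (ArithmeticFunction.cardDistinctFactors n : ℝ) ^ 2 -
        2 * L * ∑ n ∈ Finset.Icc 1 N, (ArithmeticFunction.cardDistinctFactors n : ℝ) +
        N * L ^ 2 := by
    have : (N : ℝ) * L ^ 2 = ∑ n ∈ Finset.Icc 1 N, L ^ 2 := by simp
    rw [this, Finset.mul_sum, ← Finset.sum_sub_distrib, ← Finset.sum_add_distrib]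
    exact Finset.sum_congr rfl fun n _ => by ring
  -- The terms `N L²` cancel, leaving `N L` from the second moment and `2 N L` from the first.
  have h1 := mul_le_mul_of_nonneg_left (mul_primeRecipSum_sub_le_sum_cardDistinctFactors N)
    (mul_nonneg zero_le_two (primeRecipSum_nonneg N))
  have h2 := sum_cardDistinctFactors_sq_le N
  rw [hexp]
  linarith

theorem hasNormalOrder_cardDistinctFactors :
    HasNormalOrder (fun n => (ArithmeticFunction.cardDistinctFactors n : ℝ)) primeRecipSum := by
  intro δ hδ
  -- Chebyshev's bound `3 N L / (δ L)²` is at most `δ N` once `L ≥ 3 / δ³`.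
  filter_upwards [tendsto_primeRecipSum_atTop.eventually_ge_atTop (3 / δ ^ 3),
    tendsto_primeRecipSum_atTop.eventually_gt_atTop 0] with N hN hN0
  set L := primeRecipSum N with hL
  refine ⟨(Finset.Icc 1 N).filter
    (fun n => δ * L < |(ArithmeticFunction.cardDistinctFactors n : ℝ) - L|), ?_, ?_⟩
  · have hcheb : (((Finset.Icc 1 N).filter
        (fun n => δ * L < |(ArithmeticFunction.cardDistinctFactors n : ℝ) - L|)).card : ℝ) *
          (δ * L) ^ 2 ≤ 3 * N * L := by
      refine le_trans ?_ (sum_cardDistinctFactors_sub_sq_le N)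
      rw [← nsmul_eq_mul]
      refine (Finset.card_nsmul_le_sum _ _ _ fun n hn => ?_).trans
        (Finset.sum_le_sum_of_subset_of_nonneg (Finset.filter_subset _ _) fun _ _ _ => sq_nonneg _)
      rw [← sq_abs (_ - L)]
      exact pow_le_pow_left₀ (by positivity) (Finset.mem_filter.1 hn).2.le 2
    rw [div_le_iff₀ (by positivity)] at hN
    refine le_of_mul_le_mul_right (hcheb.trans ?_) (show 0 < (δ * L) ^ 2 by positivity)
    calc 3 * N * L ≤ (L * δ ^ 3) * N * L := by gcongr
      _ = δ * N * (δ * L) ^ 2 := by ring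
  · intro n hn hnB
    by_contra! hlt
    exact hnB (Finset.mem_filter.2 ⟨hn, hlt⟩)

/-! ### Comparing `log d(n)` with `log 2 · ω(n)`. -/

theorem two_pow_cardDistinctFactors_le_card_divisors {n : ℕ} (hn : n ≠ 0) :
    2 ^ ArithmeticFunction.cardDistinctFactors n ≤ n.divisors.card := by
  rw [show ArithmeticFunction.cardDistinctFactors n = n.primeFactors.card from rfl,
    Nat.card_divisors hn]
  refine Finset.pow_card_le_prod _ _ _ fun p hp => ?_
  have := (Nat.prime_of_mem_primeFactors hp).factorization_pos_of_dvd hn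
    (Nat.dvd_of_mem_primeFactors hp)
  omega

theorem Squarefree.card_divisors_eq_two_pow {n : ℕ} (hn : Squarefree n) :
    n.divisors.card = 2 ^ ArithmeticFunction.cardDistinctFactors n := by
  rw [show ArithmeticFunction.cardDistinctFactors n = n.primeFactors.card from rfl,
    Nat.card_divisors hn.ne_zero, ← Finset.prod_const]
  refine Finset.prod_congr rfl fun p hp => ?_
  have := (Nat.prime_of_mem_primeFactors hp).factorization_pos_of_dvd hn.ne_zero
    (Nat.dvd_of_mem_primeFactors hp)
  have := hn.natFactorization_le_one p
  omega

/-- Write `n = m² s` with `s` squarefree; `d` is submultiplicative, and the crude bound `d(m²) ≤ m²`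
suffices. -/
theorem exists_sq_dvd_card_divisors_le {n : ℕ} (hn : n ≠ 0) :
    ∃ m : ℕ, m ≠ 0 ∧ m ^ 2 ∣ n ∧
      n.divisors.card ≤ m ^ 2 * 2 ^ ArithmeticFunction.cardDistinctFactors n := by
  obtain ⟨s, m, rfl, hs⟩ := Nat.sq_mul_squarefree n
  refine ⟨m, fun h => hn (by simp [h]), dvd_mul_right _ _, ?_⟩
  calc (m ^ 2 * s).divisors.card ≤ (m ^ 2).divisors.card * s.divisors.card := by
        rw [Nat.divisors_mul]
        exact Finset.card_mul_le
    _ ≤ m ^ 2 * 2 ^ ArithmeticFunction.cardDistinctFactors s := by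
        rw [hs.card_divisors_eq_two_pow]
        exact Nat.mul_le_mul_right _ (Nat.card_divisors_le_self _)
    _ ≤ _ := Nat.mul_le_mul_left _ (Nat.pow_le_pow_right two_pos
        (Finset.card_le_card (Nat.primeFactors_mono (dvd_mul_left s _) hn)))

theorem abs_floor_log_card_divisors_sub_le {n k : ℕ} (hn : n ≠ 0)
    (hk : ∀ m, m ^ 2 ∣ n → m ≤ k) :
    |(⌊Real.log (n.divisors.card : ℝ)⌋₊ : ℝ) -
      Real.log 2 * ArithmeticFunction.cardDistinctFactors n| ≤ Real.log (k ^ 2) + 1 := by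
  have hk0 : 0 < k := hk 1 (by simp)
  have hlogk : 0 ≤ Real.log ((k : ℝ) ^ 2) :=
    Real.log_nonneg (one_le_pow₀ (by exact_mod_cast hk0))
  have hd : 0 < n.divisors.card := Finset.card_pos.2 (Nat.nonempty_divisors.2 hn)
  have hlog0 : 0 ≤ Real.log (n.divisors.card : ℝ) := Real.log_natCast_nonneg _
  have hfl := Nat.floor_le hlog0
  have hfl' := Nat.lt_floor_add_one (Real.log (n.divisors.card : ℝ))
  have hlow : Real.log 2 * ArithmeticFunction.cardDistinctFactors n ≤
      Real.log (n.divisors.card : ℝ) := by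
    rw [mul_comm, ← Real.log_pow]
    exact Real.log_le_log (by positivity)
      (by exact_mod_cast two_pow_cardDistinctFactors_le_card_divisors hn)
  have hup : Real.log (n.divisors.card : ℝ) ≤
      Real.log (k ^ 2) + Real.log 2 * ArithmeticFunction.cardDistinctFactors n := by
    obtain ⟨m, hm0, hmn, hm⟩ := exists_sq_dvd_card_divisors_le hn
    rw [mul_comm (Real.log 2), ← Real.log_pow, ← Real.log_mul (by positivity) (by positivity)]
    refine Real.log_le_log (by exact_mod_cast hd) ?_
    exact_mod_cast hm.trans (Nat.mul_le_mul_right _ (Nat.pow_le_pow_left (hk m hmn) 2))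
  rw [abs_le]
  constructor <;> linarith

/-- The exceptional `n` are those divisible by `m²` for some `m > k`; their proportion is at most `∑
1 / m² ≤ 2 / (k + 1)`. -/
theorem hasNormalOrder_floor_log_card_divisors :
    HasNormalOrder (fun n => (⌊Real.log (n.divisors.card : ℝ)⌋₊ : ℝ))
      (fun N => Real.log 2 * primeRecipSum N) := by
  refine hasNormalOrder_cardDistinctFactors.of_abs_sub_mul_le tendsto_primeRecipSum_atTop
    (Real.log_pos one_lt_two) fun κ hκ => ?_
  obtain ⟨k, hk⟩ := exists_nat_gt (2 / κ)
  refine ⟨Real.log (k ^ 2) + 1, fun N => ⟨(Finset.Ioo k (N + 1)).biUnion fun m =>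
    (Finset.Icc 1 N).filter (m ^ 2 ∣ ·), ?_, fun n hn hnB => ?_⟩⟩
  · have hkκ : 2 / ((k : ℝ) + 1) ≤ κ := by
      rw [div_lt_iff₀ hκ] at hk
      rw [div_le_iff₀ (by positivity)]
      linarith
    calc _ ≤ ∑ m ∈ Finset.Ioo k (N + 1), (((Finset.Icc 1 N).filter (m ^ 2 ∣ ·)).card : ℝ) := by
          exact_mod_cast Finset.card_biUnion_le
      _ ≤ ∑ m ∈ Finset.Ioo k (N + 1), N * ((m : ℝ) ^ 2)⁻¹ := by
          refine Finset.sum_le_sum fun m _ => ?_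
          rw [card_filter_dvd_Icc, ← div_eq_mul_inv]
          exact_mod_cast Nat.cast_div_le (α := ℝ) (m := N) (n := m ^ 2)
      _ ≤ N * (2 / ((k : ℝ) + 1)) := by
          rw [← Finset.mul_sum]
          exact mul_le_mul_of_nonneg_left (sum_Ioo_inv_sq_le k (N + 1)) (Nat.cast_nonneg N)
      _ ≤ κ * N := by
          rw [mul_comm]
          gcongr
  · obtain ⟨hn1, hnN⟩ := Finset.mem_Icc.1 hn
    refine abs_floor_log_card_divisors_sub_le (by omega) fun m hm => ?_
    by_contra! hlt
    have hmn : m ≤ n := (Nat.le_self_pow two_ne_zero m).trans (Nat.le_of_dvd hn1 hm)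
    exact hnB (Finset.mem_biUnion.2
      ⟨m, Finset.mem_Ioo.2 ⟨hlt, by omega⟩, Finset.mem_filter.2 ⟨hn, hm⟩⟩)

theorem hasShortWindows_cardDistinctFactors :
    HasShortWindows (fun n => ArithmeticFunction.cardDistinctFactors n) :=
  hasNormalOrder_cardDistinctFactors.hasShortWindows primeRecipSum_mono
    tendsto_primeRecipSum_atTop primeRecipSum_succ_le

theorem hasShortWindows_floor_log_card_divisors :
    HasShortWindows (fun n => ⌊Real.log (n.divisors.card : ℝ)⌋₊) := by
  have hlog : 0 < Real.log 2 := Real.log_pos one_lt_two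
  -- Scaling by `log 2 ≤ 1` keeps the steps of the normal order at most 1.
  have hlog1 : Real.log 2 ≤ 1 := by linarith [Real.log_two_lt_d9]
  refine hasNormalOrder_floor_log_card_divisors.hasShortWindows
    (primeRecipSum_mono.const_mul hlog.le) (tendsto_primeRecipSum_atTop.const_mul_atTop hlog)
    fun N => ?_
  have := mul_le_mul_of_nonneg_left (primeRecipSum_succ_le N) hlog.le
  linarith

theorem mainTheorem6 :
    StrongSweepingOut.{u} (fun n => ArithmeticFunction.cardDistinctFactors n) ∧
    StrongSweepingOut.{u} (fun n => ⌊Real.log (n.divisors.card : ℝ)⌋₊) :=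
  ⟨hasShortWindows_cardDistinctFactors.strongSweepingOut,
    hasShortWindows_floor_log_card_divisors.strongSweepingOut⟩
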